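/- Let $(\Omega,\mathcal C,P)$ be a probability space and let $u:[0,1]\to\mathbb R$ be strictly increasing and concave with $u(0)=0$, $u(1)=1$ and with (right) derivative $u'(0)$ at $0$ satisfying $0<u'(0)<\infty$. Let $\mu=u\circ P$ be the corresponding distorted probability, $\mu(A)=u(P(A))$ for $A\in\mathcal C$. For each $n\in\mathbb N=\{1,2,\dots\}$ let $V_{n,1},\dots,V_{n,n+1}:\Omega\to[0,1]$ be independent random variables uniformly distributed on $[0,1]$, and let $Y_{n,0}\le Y_{n,1}\le\dots\le Y_{n,n}$ be their order statistics, i.e. these $n+1$ variables arranged in increasing order. Let $f:[0,1]\times\Omega\to\mathbb R$ be such that $f(x,\cdot)$ is $\mathcal C$-measurable for each $x\in[0,1]$ and such that $f(x,\omega)$ is continuous at each $x\in[0,1]$ uniformly with respect to $\omega\in\Omega$ (for every $x\in[0,1]$ and $\varepsilon>0$ there is $\eta>0$ with $|f(y,\omega)-f(x,\omega)|<\varepsilon$ for all $\omega\in\Omega$ and all $y\in[0,1]$ with $|y-x|<\eta$). Put $$B_n(f,Y)(x,\omega)=\sum_{k=0}^{n}f(Y_{n,k}(\omega),\omega)\binom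 nk x^k(1-x)^{n-k},$$ $$K(f;\delta)=\sup_{\omega\in\Omega}\ \sup\{|f(x,\omega)-f(y,\omega)|:x,y\in[0,1],\ |x-y|\le\delta\}\qquad(\delta\ge0),$$ and let $c=\frac{4306+837\sqrt6}{5832}=1.0898\ldots$ be Sikkema's constant. Let $(\tau(n))_{n\ge1}$ be a real sequence with $\tau(n)\to\infty$, $\tau(n)/n\to0$ as $n\to\infty$, and $\tau(n)\ge1$ for all $n\ge1$. Then for every $r\in(0,1)$ and every $n\in\mathbb N$ the set below belongs to $\mathcal C$ and $$\mu\left(\left\{\omega\in\Omega:\sup_{x\in[0,1]}|B_n(f,Y)(x,\omega)-f(x,\omega)|>(1+c)\,K\!\left(f;\sqrt{\tfrac{\tau(n)}{n}}\right)\right\}\right)\le u'(0)\,\frac{n+1}{\sqrt{1-r}}\,\exp\!\left(-\frac{3r}{2}\,\tau(n)\right).$$ -/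

import Mathlib

namespace RandomBernstein

noncomputable section

/-- The distorted probability `μ = u ∘ P`, i.e. `μ A = u (P A)`. -/
def distortedProbability {Ω : Type*} [MeasurableSpace Ω] (u : ℝ → ℝ)
    (P : MeasureTheory.Measure Ω) (A : Set Ω) : ℝ :=
  u (P.real A)

/-- The order statistics of a finite sample `v`, listed in increasing order:
`orderStatistics v k` is the `(k+1)`-th smallest entry of `v`. -/
def orderStatistics {m : ℕ} (v : Fin m → unitInterval) : Fin m → unitInterval :=
  fun k => v (Tuple.sort v k)

/-- The triangular array `Y n k`, `0 ≤ k ≤ n`, where `Y n k` is the `(k+1)`-th order statistic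
of the `n + 1` random variables `V n 0, …, V n n`. -/
def nodes {Ω : Type*} (V : (n : ℕ) → Fin (n + 1) → Ω → unitInterval)
    (n : ℕ) (k : Fin (n + 1)) (ω : Ω) : unitInterval :=
  orderStatistics (fun j => V n j ω) k

/-- The stochastic Bernstein polynomial
`B_n(f,Y)(x,ω) = ∑_{k=0}^n f(Y_{n,k}(ω),ω) * (n choose k) * x^k * (1-x)^(n-k)`. -/
def stochasticBernstein {Ω : Type*} (f : unitInterval → Ω → ℝ)
    (Y : (n : ℕ) → Fin (n + 1) → Ω → unitInterval) (n : ℕ) (x : unitInterval) (ω : Ω) : ℝ :=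
  ∑ k : Fin (n + 1), f (Y n k ω) ω *
    ((n.choose (k : ℕ) : ℝ) * (x : ℝ) ^ (k : ℕ) * (1 - (x : ℝ)) ^ (n - (k : ℕ)))

/-- The modulus of continuity of the sample function `f(·,ω)`:
`sup {|f(x,ω) - f(y,ω)| : x, y ∈ [0,1], |x - y| ≤ δ}`. -/
def sampleModulus {Ω : Type*} (f : unitInterval → Ω → ℝ) (δ : ℝ) (ω : Ω) : ℝ :=
  sSup {t : ℝ | ∃ x y : unitInterval, |(x : ℝ) - (y : ℝ)| ≤ δ ∧ t = |f x ω - f y ω|}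

/-- The quantity `K(f;δ)`, the supremum over `ω` of the moduli of continuity of the sample
functions. (When the sample functions are equicontinuous, all the suprema here are finite, by
compactness of `[0,1]`.) -/
def uniformModulus {Ω : Type*} (f : unitInterval → Ω → ℝ) (δ : ℝ) : ℝ :=
  ⨆ ω : Ω, sampleModulus f δ ω

/-- Sikkema's constant `c = 1.0898…`. -/
def sikkemaConstant : ℝ := (4306 + 837 * Real.sqrt 6) / 5832

end

end RandomBernstein

/-!
The classical route to a bound of this kind compares `f (Y k)` with `f (k / n)` and then quotes
Sikkema's theorem on the approximation constant of the Bernstein operators. The sharp constant is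
not needed here, because the probability bound is trivial in the only range where it would be.

Put `t = τ n`, `δ = √(t / n)` and `K = K(f; δ)`. If `n ≥ 2` and `t < 3 / 2`, the bound
claimed for the probability `P` is at least `1` (`one_le_bound`), so there is nothing to prove.
Otherwise, on the event that every node satisfies `|Y k - k / n| ≤ δ`, replacing `f (Y k)` by
`f (k / n)` costs at most `K`, and `|f (k / n) - f x| ≤ K (1 + (|k / n - x| / δ) ^ 4)` by chaining
(`abs_sub_le_one_add_pow_four`). The fourth central moment of the
binomial law is at most `3 n² / 16` (and at most `1 / 12` for `n = 1`), so the deterministic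
Bernstein error is at most `(1 + 3 / (16 t²)) K ≤ c K` for `t ≥ 3 / 2`, respectively
`(1 + 1 / 12) K ≤ c K` for `n = 1` (`abs_stochasticBernstein_sub_le`).

It remains to bound the probability that some node is farther than `δ` from `k / n`. The event
`Y k > p` says that at least `n + 1 - k` of the `n + 1` sample points exceed `p`, and similarly for
`Y k < p`; Hoeffding's inequality for these binomial counts gives `exp (-2 (n + 1) δ²)` for each of
the `2 (n + 1)` events (`measureReal_exists_nodes_far_le`), and
`2 exp (-2 t) ≤ exp (-3 r t / 2) / √(1 - r)` (`two_mul_exp_le`). Finally concavity gives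
`u p ≤ u'(0) p`, which transfers the bound to the distorted probability.
-/

/-! ### The fourth central moment of the binomial distribution -/

namespace RandomBernstein

open MeasureTheory ProbabilityTheory Finset

/-- The shift `a` makes the induction on `n` close: conditioning on the last Bernoulli trial turns
the statement for `n + 1` and `a` into those for `n` and `a - x`, `a + 1 - x`. -/
theorem binomial_fourth_central_moment (n : ℕ) (x a : ℝ) :
    ∑ k ∈ range (n + 1), (n.choose k : ℝ) * (x ^ k * (1 - x) ^ (n - k) * (k - n * x + a) ^ 4) =
      n * (x * (1 - x)) + 3 * n * (n - 2) * (x * (1 - x)) ^ 2 +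
        4 * a * (n * (x * (1 - x)) * (1 - 2 * x)) + 6 * a ^ 2 * (n * (x * (1 - x))) + a ^ 4 := by
  induction n generalizing a with
  | zero => simp
  | succ n ih =>
    have h := sum_choose_succ_mul
      (fun i j ↦ x ^ i * (1 - x) ^ j * ((i : ℝ) - (n + 1 : ℕ) * x + a) ^ 4) n
    rw [h]
    have h₁ : ∑ i ∈ range (n + 1), (n.choose i : ℝ) *
        (x ^ i * (1 - x) ^ (n + 1 - i) * ((i : ℝ) - (n + 1 : ℕ) * x + a) ^ 4) =
        (1 - x) * ∑ k ∈ range (n + 1),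
          (n.choose k : ℝ) * (x ^ k * (1 - x) ^ (n - k) * (k - n * x + (a - x)) ^ 4) := by
      rw [mul_sum]
      refine sum_congr rfl fun i hi ↦ ?_
      rw [Nat.succ_sub (Nat.lt_succ_iff.mp (mem_range.mp hi)), pow_succ (1 - x)]
      push_cast
      ring
    have h₂ : ∑ i ∈ range (n + 1), (n.choose i : ℝ) *
        (x ^ (i + 1) * (1 - x) ^ (n - i) * (((i + 1 : ℕ) : ℝ) - (n + 1 : ℕ) * x + a) ^ 4) =
        x * ∑ k ∈ range (n + 1),
          (n.choose k : ℝ) * (x ^ k * (1 - x) ^ (n - k) * (k - n * x + (a + 1 - x)) ^ 4) := by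
      rw [mul_sum]
      refine sum_congr rfl fun i hi ↦ ?_
      push_cast
      ring
    rw [h₁, h₂, ih, ih]
    push_cast
    ring

theorem sum_bernstein_mul_fourth_pow (n : ℕ) (x : unitInterval) :
    ∑ k : Fin (n + 1), bernstein n k x * ((k : ℝ) - n * x) ^ 4 =
      n * (x * (1 - x)) + 3 * n * (n - 2) * (x * (1 - x) : ℝ) ^ 2 := by
  have h := binomial_fourth_central_moment n x 0
  rw [sum_range] at h
  simp only [add_zero, ← mul_assoc] at h
  simp only [bernstein_apply]
  rw [h]
  ring

/-! ### Moduli of continuity -/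

/-- Chaining: two points at distance at most `N * δ` are joined by `N` steps of length at most
`δ` inside `[0,1]`. -/
theorem abs_sub_le_nat_mul {g : unitInterval → ℝ} {K δ : ℝ}
    (h : ∀ x y : unitInterval, |(x : ℝ) - y| ≤ δ → |g x - g y| ≤ K) (N : ℕ) :
    ∀ x y : unitInterval, |(x : ℝ) - y| ≤ N * δ → |g x - g y| ≤ N * K := by
  induction N with
  | zero =>
    intro x y hxy
    have : x = y := by
      apply Subtype.ext
      have := abs_nonpos_iff.mp (hxy.trans_eq (by simp))
      linarith
    simp [this]
  | succ N ih =>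
    intro x y hxy
    -- The first step of the chain covers the fraction `1 / (N + 1)` of the segment.
    have hN : (0 : ℝ) < N + 1 := by positivity
    push_cast at hxy ⊢
    have hz : ((N : ℝ) * x + y) / (N + 1) ∈ Set.Icc (0 : ℝ) 1 := by
      constructor
      · exact div_nonneg (add_nonneg (mul_nonneg N.cast_nonneg x.2.1) y.2.1) hN.le
      · rw [div_le_one hN]
        have := mul_le_mul_of_nonneg_left x.2.2 (Nat.cast_nonneg (α := ℝ) N)
        linarith [y.2.2]
    have h₁ : |g x - g ⟨_, hz⟩| ≤ K := by
      apply h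
      have : (x : ℝ) - (N * x + y) / (N + 1) = (x - y) / (N + 1) := by field_simp; ring
      rw [this, abs_div, abs_of_pos hN, div_le_iff₀ hN]
      linarith
    have h₂ : |g ⟨_, hz⟩ - g y| ≤ N * K := by
      apply ih
      have : ((N : ℝ) * x + y) / (N + 1) - y = N * ((x - y) / (N + 1)) := by field_simp; ring
      rw [this, abs_mul, abs_div, abs_of_pos hN, Nat.abs_cast]
      gcongr
      rw [div_le_iff₀ hN]
      linarith
    have := abs_sub_le (g x) (g ⟨_, hz⟩) (g y)
    linarith

/-- A polynomial substitute for the number `⌈|x - y| / δ⌉` of steps in the chain. -/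
theorem abs_sub_le_one_add_pow_four {g : unitInterval → ℝ} {K δ : ℝ} (hδ : 0 < δ) (hK : 0 ≤ K)
    (h : ∀ x y : unitInterval, |(x : ℝ) - y| ≤ δ → |g x - g y| ≤ K) (x y : unitInterval) :
    |g x - g y| ≤ K * (1 + (((x : ℝ) - y) / δ) ^ 4) := by
  have hp : (((x : ℝ) - y) / δ) ^ 4 = (|(x : ℝ) - y| / δ) ^ 4 := by
    rw [← Even.pow_abs (by decide), abs_div, abs_of_pos hδ]
  set t := |(x : ℝ) - y| / δ with ht
  have ht0 : 0 ≤ t := by positivity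
  rw [hp]
  by_cases h1 : t ≤ 1
  · refine (h x y ((div_le_one hδ).mp h1)).trans ?_
    nlinarith [pow_nonneg ht0 4]
  · push Not at h1
    have h2 := abs_sub_le_nat_mul h ⌈t⌉₊ x y (by
      rw [← div_le_iff₀ hδ]
      exact Nat.le_ceil t)
    refine h2.trans ?_
    rw [mul_comm]
    gcongr
    have h3 := (Nat.ceil_lt_add_one ht0).le
    have h4 : t ≤ t ^ 4 := le_self_pow₀ h1.le (by norm_num)
    linarith

variable {Ω : Type*}

/-- Uniform boundedness of the oscillations, which makes the suprema defining `uniformModulus`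
genuine (finite) ones. -/
theorem exists_abs_sub_le {f : unitInterval → Ω → ℝ}
    (hf : Equicontinuous (fun (ω : Ω) (x : unitInterval) ↦ f x ω)) :
    ∃ M : ℝ, ∀ x y ω, |f x ω - f y ω| ≤ M := by
  obtain ⟨δ, hδ, h⟩ := Metric.uniformEquicontinuous_iff.mp
    (CompactSpace.uniformEquicontinuous_of_equicontinuous hf) 1 one_pos
  obtain ⟨N, hN⟩ := exists_nat_gt (1 / (δ / 2))
  refine ⟨N * 1, fun x y ω ↦ abs_sub_le_nat_mul (g := fun x ↦ f x ω) (δ := δ / 2)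
    (fun x y hxy ↦ (h x y ?_ ω).le) N x y ?_⟩
  · rw [Subtype.dist_eq, Real.dist_eq]
    linarith
  · rw [div_lt_iff₀ (by positivity)] at hN
    refine le_trans ?_ hN.le
    rw [abs_le]
    constructor <;> linarith [x.2.1, x.2.2, y.2.1, y.2.2]

theorem abs_sub_le_uniformModulus {f : unitInterval → Ω → ℝ}
    (hf : Equicontinuous (fun (ω : Ω) (x : unitInterval) ↦ f x ω)) {δ : ℝ} (ω : Ω)
    {x y : unitInterval} (hxy : |(x : ℝ) - y| ≤ δ) :
    |f x ω - f y ω| ≤ uniformModulus f δ := by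
  obtain ⟨M, hM⟩ := exists_abs_sub_le hf
  have hδ : 0 ≤ δ := (abs_nonneg _).trans hxy
  have h₁ : |f x ω - f y ω| ≤ sampleModulus f δ ω :=
    le_csSup ⟨M, by rintro _ ⟨x, y, -, rfl⟩; exact hM x y ω⟩ ⟨x, y, hxy, rfl⟩
  refine h₁.trans (le_ciSup (f := sampleModulus f δ) ⟨M, ?_⟩ ω)
  rintro _ ⟨ω, rfl⟩
  refine csSup_le ⟨_, x, x, by simpa using hδ, rfl⟩ ?_
  rintro _ ⟨x, y, -, rfl⟩
  exact hM x y ω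

/-! ### The deterministic approximation error -/

theorem lt_sikkemaConstant : (1089 / 1000 : ℝ) < sikkemaConstant := by
  have : (2.449 : ℝ) < √6 := by
    rw [Real.lt_sqrt (by norm_num)]
    norm_num
  unfold sikkemaConstant
  rw [lt_div_iff₀ (by norm_num)]
  linarith

/-- The fourth central moment of the binomial law, at the scale `√(t / n)` of the modulus of
continuity, is within the slack `c - 1` of Sikkema's constant unless `n ≥ 2` and `t` is close
to `1`. -/
theorem fourth_moment_le {n : ℕ} (hn : 1 ≤ n) {t : ℝ} (ht : 1 ≤ t)
    (hnt : n = 1 ∨ 3 / 2 ≤ t) (x : unitInterval) :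
    (n * (x * (1 - x)) + 3 * n * (n - 2) * (x * (1 - x)) ^ 2 : ℝ) ≤
      (sikkemaConstant - 1) * (n ^ 2 * t ^ 2) := by
  have hc := lt_sikkemaConstant
  have hn' : (1 : ℝ) ≤ n := by exact_mod_cast hn
  set X : ℝ := x * (1 - x) with hX
  have hX0 : 0 ≤ X := mul_nonneg x.2.1 (by linarith [x.2.2])
  have hX1 : X ≤ 1 / 4 := by nlinarith [sq_nonneg ((x : ℝ) - 1 / 2)]
  have ht2 : 1 ≤ t ^ 2 := one_le_pow₀ ht
  rcases hnt with rfl | h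
  · -- Here the moment is `X - 3 * X ^ 2`, whose maximum `1 / 12` is attained at `X = 1 / 6`.
    push_cast
    have h1 : (1089 / 1000 - 1) * 1 ≤ (sikkemaConstant - 1) * t ^ 2 := by
      gcongr
      linarith
    nlinarith [sq_nonneg (X - 1 / 6)]
  · have h0 : X - 6 * X ^ 2 ≤ 3 * n * (1 / 16 - X ^ 2) := by
      have h16 : 0 ≤ 1 / 16 - X ^ 2 := by nlinarith
      nlinarith [mul_nonneg (sub_nonneg.mpr hn') h16, sq_nonneg (X - 1 / 6)]
    have h1 : n * X + 3 * n * (n - 2) * X ^ 2 ≤ 3 / 16 * (n : ℝ) ^ 2 := by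
      nlinarith [mul_le_mul_of_nonneg_left h0 (zero_le_one.trans hn')]
    have h2 : (sikkemaConstant - 1) * ((n : ℝ) ^ 2 * t ^ 2) ≥
        (1089 / 1000 - 1) * (n ^ 2 * (3 / 2) ^ 2) := by
      gcongr
      linarith
    nlinarith [sq_nonneg (n : ℝ)]

/-- The mean oscillation is bounded with Sikkema's constant; here this follows from the fourth
moment alone, since small values of `t` are excluded for `n ≥ 2`. -/
theorem sum_bernstein_mul_modulus_le {g : unitInterval → ℝ} {K t : ℝ} {n : ℕ} (hn : 1 ≤ n)
    (ht : 1 ≤ t) (hnt : n = 1 ∨ 3 / 2 ≤ t) (hK : 0 ≤ K)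
    (h : ∀ x y : unitInterval, |(x : ℝ) - y| ≤ √(t / n) → |g x - g y| ≤ K) (x : unitInterval) :
    ∑ k : Fin (n + 1), |g (bernstein.z k) - g x| * bernstein n k x ≤ sikkemaConstant * K := by
  have hn' : (0 : ℝ) < n := by exact_mod_cast hn
  have ht' : 0 < t := by linarith
  have hδ : 0 < √(t / n) := by positivity
  have hδ4 : √(t / n) ^ 4 = (t / n) ^ 2 := by
    rw [show 4 = 2 * 2 from rfl, pow_mul, Real.sq_sqrt (by positivity)]
  calc ∑ k : Fin (n + 1), |g (bernstein.z k) - g x| * bernstein n k x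
      ≤ ∑ k : Fin (n + 1), (K * bernstein n k x +
          K / (n ^ 2 * t ^ 2) * (bernstein n k x * ((k : ℝ) - n * x) ^ 4)) := by
        refine sum_le_sum fun k _ ↦ ?_
        refine (mul_le_mul_of_nonneg_right (abs_sub_le_one_add_pow_four hδ hK h _ x)
          bernstein_nonneg).trans_eq ?_
        rw [div_pow, hδ4]
        simp only [bernstein.z]
        field_simp
    _ = K + K / (n ^ 2 * t ^ 2) *
          (n * (x * (1 - x)) + 3 * n * (n - 2) * (x * (1 - x) : ℝ) ^ 2) := by
        rw [sum_add_distrib, ← mul_sum, ← mul_sum, bernstein.probability,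
          sum_bernstein_mul_fourth_pow, mul_one]
    _ ≤ K + K / (n ^ 2 * t ^ 2) * ((sikkemaConstant - 1) * (n ^ 2 * t ^ 2)) := by
        gcongr
        exact fourth_moment_le hn ht hnt x
    _ = sikkemaConstant * K := by
        field_simp
        ring

theorem continuous_stochasticBernstein (f : unitInterval → Ω → ℝ)
    (Y : (n : ℕ) → Fin (n + 1) → Ω → unitInterval) (n : ℕ) (ω : Ω) :
    Continuous fun x ↦ stochasticBernstein f Y n x ω := by
  unfold stochasticBernstein
  fun_prop

theorem abs_stochasticBernstein_sub_le {f : unitInterval → Ω → ℝ}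
    {Y : (n : ℕ) → Fin (n + 1) → Ω → unitInterval} {n : ℕ} {ω : Ω} {K t : ℝ} (hn : 1 ≤ n)
    (ht : 1 ≤ t) (hnt : n = 1 ∨ 3 / 2 ≤ t)
    (h : ∀ x y : unitInterval, |(x : ℝ) - y| ≤ √(t / n) → |f x ω - f y ω| ≤ K)
    (hY : ∀ k : Fin (n + 1), |(Y n k ω : ℝ) - (k : ℕ) / n| ≤ √(t / n)) (x : unitInterval) :
    |stochasticBernstein f Y n x ω - f x ω| ≤ (1 + sikkemaConstant) * K := by
  have hK : 0 ≤ K := (abs_nonneg _).trans (h x x (by simpa using Real.sqrt_nonneg (t / n)))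
  have h₁ : stochasticBernstein f Y n x ω - f x ω =
      ∑ k : Fin (n + 1), (f (Y n k ω) ω - f x ω) * bernstein n k x := by
    simp only [sub_mul, sum_sub_distrib, ← mul_sum, bernstein.probability, mul_one]
    simp only [stochasticBernstein, bernstein_apply]
  rw [h₁]
  calc |∑ k : Fin (n + 1), (f (Y n k ω) ω - f x ω) * bernstein n k x|
      ≤ ∑ k : Fin (n + 1), |(f (Y n k ω) ω - f x ω) * bernstein n k x| := abs_sum_le_sum_abs _ _
    _ ≤ ∑ k : Fin (n + 1), (K * bernstein n k x +
          |f (bernstein.z k) ω - f x ω| * bernstein n k x) := by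
        refine sum_le_sum fun k _ ↦ ?_
        rw [abs_mul, abs_of_nonneg (bernstein_nonneg (n := n)), ← add_mul]
        refine mul_le_mul_of_nonneg_right ?_ bernstein_nonneg
        exact (abs_sub_le _ (f (bernstein.z k) ω) _).trans (by gcongr; exact h _ _ (hY k))
    _ ≤ K + sikkemaConstant * K := by
        rw [sum_add_distrib, ← mul_sum, bernstein.probability, mul_one]
        gcongr
        exact sum_bernstein_mul_modulus_le hn ht hnt hK h x
    _ = (1 + sikkemaConstant) * K := by ring

/-! ### Order statistics as counts -/

theorem card_filter_orderStatistics {m : ℕ} (v : Fin m → unitInterval) (A : Set unitInterval)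
    [DecidablePred (· ∈ A)] :
    #{j | orderStatistics v j ∈ A} = #{j | v j ∈ A} :=
  card_equiv (Tuple.sort v) fun i ↦ by simp only [mem_filter_univ]; rfl

theorem monotone_orderStatistics {m : ℕ} (v : Fin m → unitInterval) :
    Monotone (orderStatistics v) :=
  Tuple.monotone_sort v

theorem orderStatistics_le_iff {m : ℕ} (v : Fin m → unitInterval) (k : Fin m) (a : unitInterval) :
    orderStatistics v k ≤ a ↔ (k : ℕ) < #{j | v j ∈ Set.Iic a} := by
  rw [← card_filter_orderStatistics v (Set.Iic a)]
  exact (Tuple.lt_card_le_iff_apply_le_of_monotone (monotone_orderStatistics v)).symm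

theorem orderStatistics_lt_iff {m : ℕ} (v : Fin m → unitInterval) (k : Fin m) (a : unitInterval) :
    orderStatistics v k < a ↔ (k : ℕ) < #{j | v j ∈ Set.Iio a} := by
  rw [← card_filter_orderStatistics v (Set.Iio a)]
  exact (Tuple.lt_card_lt_iff_apply_lt_of_monotone (monotone_orderStatistics v)).symm

theorem lt_orderStatistics_iff {m : ℕ} (v : Fin m → unitInterval) (k : Fin m) (a : unitInterval) :
    a < orderStatistics v k ↔ m ≤ k + #{j | v j ∈ Set.Ioi a} := by
  have h := card_filter_add_card_filter_not (s := univ) (fun j ↦ v j ∈ Set.Iic a)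
  rw [← not_le, orderStatistics_le_iff]
  simp only [Set.mem_Iic, not_le, card_univ, Fintype.card_fin, Set.mem_Ioi] at h ⊢
  omega

variable [MeasurableSpace Ω]

theorem measurable_nodes {V : (n : ℕ) → Fin (n + 1) → Ω → unitInterval}
    (hV : ∀ n j, Measurable (V n j)) (n : ℕ) (k : Fin (n + 1)) : Measurable (nodes V n k) := by
  refine measurable_of_Iic fun a ↦ ?_
  have h : nodes V n k ⁻¹' Set.Iic a =
      {ω | (k : ℕ) < ∑ j, (V n j ⁻¹' Set.Iic a).indicator (fun _ ↦ 1) ω} := by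
    classical
    ext ω
    simp only [Set.mem_preimage, Set.mem_Iic, nodes, orderStatistics_le_iff, card_filter,
      Set.mem_ofPred_eq, Set.indicator_apply]
  rw [h]
  refine measurableSet_lt measurable_const (Finset.measurable_fun_sum _ fun j _ ↦ ?_)
  exact measurable_const.indicator (hV n j measurableSet_Iic)

/-! ### Concentration of the nodes -/

variable {P : Measure Ω} [IsProbabilityMeasure P]

/-- Hoeffding's inequality for the number of points of a uniform sample that fall in `A`. -/
theorem measureReal_card_filter_ge_le {m : ℕ} {v : Fin m → Ω → unitInterval}
    (hv : ∀ j, Measurable (v j)) (hindep : iIndepFun v P)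
    (hunif : ∀ j, P.map (v j) = volume) {A : Set unitInterval} [DecidablePred (· ∈ A)]
    (hA : MeasurableSet A) {ε : ℝ} (hε : 0 ≤ ε) :
    P.real {ω | ε ≤ #{j | v j ω ∈ A} - m * (volume : Measure unitInterval).real A} ≤
      Real.exp (-(2 * ε ^ 2 / m)) := by
  set g : unitInterval → ℝ := A.indicator (fun _ ↦ 1) with hg_def
  have hg : Measurable g := measurable_const.indicator hA
  set q : ℝ := (volume : Measure unitInterval).real A with hq
  have hmean : ∀ j, P[fun ω ↦ g (v j ω)] = q := by
    intro j
    rw [← integral_map (hv j).aemeasurable hg.aestronglyMeasurable, hunif j, hg_def,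
      integral_indicator hA]
    simp [hq]
  have hsub : ∀ j ∈ (univ : Finset (Fin m)),
      HasSubgaussianMGF (fun ω ↦ g (v j ω) - q) ((‖(1 : ℝ) - 0‖₊ / 2) ^ 2) P := by
    intro j _
    have := hasSubgaussianMGF_of_mem_Icc (μ := P) (X := fun ω ↦ g (v j ω)) (a := 0) (b := 1)
      (hg.comp (hv j)).aemeasurable (ae_of_all _ fun ω ↦ by
        simp only [hg_def, Set.indicator_apply]
        split_ifs <;> simp)
    rwa [hmean j] at this
  have hind : iIndepFun (fun j ω ↦ g (v j ω) - q) P :=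
    hindep.comp (fun _ y ↦ g y - q) (fun _ ↦ hg.sub_const q)
  have key := HasSubgaussianMGF.measure_sum_ge_le_of_iIndepFun hind hsub hε
  have hset : {ω | ε ≤ ∑ j, (g (v j ω) - q)} = {ω | ε ≤ #{j | v j ω ∈ A} - m * q} := by
    ext ω
    simp [hg_def, Set.indicator_apply, sum_sub_distrib]
  rw [hset] at key
  refine key.trans_eq ?_
  congr 1
  simp
  ring

variable {V : (n : ℕ) → Fin (n + 1) → Ω → unitInterval}

theorem measureReal_nodes_gt_le (hV : ∀ n j, Measurable (V n j))
    (hindep : ∀ n, iIndepFun (V n) P) (hunif : ∀ n j, P.map (V n j) = volume) {n : ℕ}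
    (k : Fin (n + 1)) {s : ℝ} (hs : 0 ≤ s) :
    P.real {ω | ((k : ℕ) / n : ℝ) + s < nodes V n k ω} ≤ Real.exp (-(2 * (n + 1) * s ^ 2)) := by
  -- Beyond `1` there is no point of `[0,1]` to compare with, and the event is empty.
  by_cases hp : ((k : ℕ) / n : ℝ) + s ≤ 1
  swap
  · have : {ω | ((k : ℕ) / n : ℝ) + s < nodes V n k ω} = ∅ := by
      ext ω
      have := (nodes V n k ω).2.2
      simp only [Set.mem_ofPred_eq, Set.mem_empty_iff_false, iff_false]
      linarith
    rw [this, measureReal_empty]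
    positivity
  have hkn : (0 : ℝ) ≤ (k : ℕ) / n := by positivity
  set a : unitInterval := ⟨(k : ℕ) / n + s, by positivity, hp⟩ with ha
  have key := measureReal_card_filter_ge_le (hV n) (hindep n) (hunif n)
    (measurableSet_Ioi (a := a)) (ε := (n + 1) * s) (by positivity)
  have hvol : (volume : Measure unitInterval).real (Set.Ioi a) = 1 - ((k : ℕ) / n + s) := by
    rw [measureReal_def, unitInterval.volume_Ioi, ENNReal.toReal_ofReal]
    linarith
  refine (measureReal_mono ?_).trans (key.trans_eq ?_)
  · intro ω hω
    have h1 : a < nodes V n k ω := hω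
    have h2 := (lt_orderStatistics_iff _ _ _).mp h1
    have h3 : ((n : ℝ) + 1) ≤ (k : ℕ) + (#{j | V n j ω ∈ Set.Ioi a} : ℕ) := by exact_mod_cast h2
    have h4 : (n : ℝ) * ((k : ℕ) / n) = (k : ℕ) := by
      rcases Nat.eq_zero_or_pos n with rfl | hn
      · simp
      · field_simp
    simp only [Set.mem_ofPred_eq, hvol]
    push_cast
    nlinarith
  · congr 1
    push_cast
    field_simp

theorem measureReal_nodes_lt_le (hV : ∀ n j, Measurable (V n j))
    (hindep : ∀ n, iIndepFun (V n) P) (hunif : ∀ n j, P.map (V n j) = volume) {n : ℕ}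
    (k : Fin (n + 1)) {s : ℝ} (hs : 0 ≤ s) :
    P.real {ω | (nodes V n k ω : ℝ) < (k : ℕ) / n - s} ≤ Real.exp (-(2 * (n + 1) * s ^ 2)) := by
  by_cases hp : 0 ≤ ((k : ℕ) / n : ℝ) - s
  swap
  · have : {ω | (nodes V n k ω : ℝ) < (k : ℕ) / n - s} = ∅ := by
      ext ω
      have := (nodes V n k ω).2.1
      simp only [Set.mem_ofPred_eq, Set.mem_empty_iff_false, iff_false]
      linarith
    rw [this, measureReal_empty]
    positivity
  have hkn : ((k : ℕ) / n : ℝ) ≤ 1 :=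
    div_le_one_of_le₀ (by exact_mod_cast Nat.lt_succ_iff.mp k.2) (by positivity)
  set a : unitInterval := ⟨(k : ℕ) / n - s, hp, by linarith⟩ with ha
  have key := measureReal_card_filter_ge_le (hV n) (hindep n) (hunif n)
    (measurableSet_Iio (a := a)) (ε := (n + 1) * s) (by positivity)
  have hvol : (volume : Measure unitInterval).real (Set.Iio a) = (k : ℕ) / n - s := by
    rw [measureReal_def, unitInterval.volume_Iio, ENNReal.toReal_ofReal hp]
  refine (measureReal_mono ?_).trans (key.trans_eq ?_)
  · intro ω hω
    have h1 : nodes V n k ω < a := hω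
    have h2 := (orderStatistics_lt_iff _ _ _).mp h1
    have h3 : ((k : ℕ) : ℝ) + 1 ≤ (#{j | V n j ω ∈ Set.Iio a} : ℕ) := by exact_mod_cast h2
    have h4 : (n : ℝ) * ((k : ℕ) / n) = (k : ℕ) := by
      rcases Nat.eq_zero_or_pos n with rfl | hn
      · simp
      · field_simp
    simp only [Set.mem_ofPred_eq, hvol]
    push_cast
    nlinarith
  · congr 1
    push_cast
    field_simp

theorem measureReal_exists_nodes_far_le (hV : ∀ n j, Measurable (V n j))
    (hindep : ∀ n, iIndepFun (V n) P) (hunif : ∀ n j, P.map (V n j) = volume) (n : ℕ)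
    {s : ℝ} (hs : 0 ≤ s) :
    P.real {ω | ∃ k : Fin (n + 1), s < |(nodes V n k ω : ℝ) - (k : ℕ) / n|} ≤
      2 * (n + 1) * Real.exp (-(2 * (n + 1) * s ^ 2)) := by
  have hset : {ω | ∃ k : Fin (n + 1), s < |(nodes V n k ω : ℝ) - (k : ℕ) / n|} ⊆
      ⋃ k : Fin (n + 1), ({ω | ((k : ℕ) / n : ℝ) + s < nodes V n k ω} ∪
        {ω | (nodes V n k ω : ℝ) < (k : ℕ) / n - s}) := by
    rintro ω ⟨k, hk⟩
    rw [Set.mem_iUnion]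
    refine ⟨k, (lt_abs.mp hk).imp ?_ ?_⟩ <;> intro h <;> simp only [Set.mem_ofPred_eq] <;> linarith
  calc _ ≤ _ := measureReal_mono hset
    _ ≤ ∑ k : Fin (n + 1), P.real ({ω | ((k : ℕ) / n : ℝ) + s < nodes V n k ω} ∪
        {ω | (nodes V n k ω : ℝ) < (k : ℕ) / n - s}) := measureReal_iUnion_fintype_le _
    _ ≤ ∑ k : Fin (n + 1), 2 * Real.exp (-(2 * (n + 1) * s ^ 2)) := by
        refine sum_le_sum fun k _ ↦ (measureReal_union_le _ _).trans ?_
        have h1 := measureReal_nodes_gt_le hV hindep hunif k hs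
        have h2 := measureReal_nodes_lt_le hV hindep hunif k hs
        linarith
    _ = _ := by
        simp
        ring

/-! ### Measurability of the exceptional set -/

theorem measurableSet_lt_iSup {X : Type*} [TopologicalSpace X] [CompactSpace X]
    [TopologicalSpace.SeparableSpace X] [Nonempty X] {g : X → Ω → ℝ}
    (hcont : ∀ ω, Continuous fun x ↦ g x ω) (hmeas : ∀ x, Measurable (g x)) (C : ℝ) :
    MeasurableSet {ω | C < ⨆ x, g x ω} := by
  obtain ⟨D, hDc, hDd⟩ := TopologicalSpace.exists_countable_dense X
  have h : {ω | C < ⨆ x, g x ω} = ⋃ x ∈ D, {ω | C < g x ω} := by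
    ext ω
    simp only [Set.mem_ofPred_eq, Set.mem_iUnion, exists_prop]
    rw [lt_ciSup_iff (isCompact_range (hcont ω)).bddAbove]
    constructor
    · rintro ⟨x, hx⟩
      obtain ⟨y, hy, hyD⟩ := hDd.exists_mem_open
        (isOpen_lt continuous_const (hcont ω)) ⟨x, hx⟩
      exact ⟨y, hy, hyD⟩
    · rintro ⟨x, -, hx⟩
      exact ⟨x, hx⟩
  rw [h]
  exact MeasurableSet.biUnion hDc fun x _ ↦ measurableSet_lt measurable_const (hmeas x)

theorem measurable_stochasticBernstein {f : unitInterval → Ω → ℝ}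
    (hf_meas : ∀ x, Measurable (f x)) (hf_cont : ∀ ω, Continuous fun x ↦ f x ω)
    {Y : (n : ℕ) → Fin (n + 1) → Ω → unitInterval} {n : ℕ} (hY : ∀ k, Measurable (Y n k))
    (x : unitInterval) : Measurable (stochasticBernstein f Y n x) := by
  have hf : Measurable (Function.uncurry f) :=
    measurable_uncurry_of_continuous_of_measurable hf_cont hf_meas
  unfold stochasticBernstein
  refine Finset.measurable_fun_sum _ fun k _ ↦ ?_
  exact (hf.comp ((hY k).prodMk measurable_id)).mul_const _

/-! ### The distortion and the exponential bounds -/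

/-- A concave function lies below its tangent at `0`. -/
theorem distortion_le {u : ℝ → ℝ} (hu_conc : ConcaveOn ℝ (Set.Icc 0 1) u) (hu0 : u 0 = 0)
    {d : ℝ} (hu' : HasDerivWithinAt u d (Set.Icc 0 1) 0) {p : ℝ} (hp : p ∈ Set.Icc (0 : ℝ) 1) :
    u p ≤ d * p := by
  rcases hp.1.eq_or_lt with rfl | h0
  · simp [hu0]
  have := hu_conc.slope_le_of_hasDerivWithinAt (by simp) hp h0 hu'
  rw [slope_def_field, hu0, sub_zero, sub_zero, div_le_iff₀ h0] at this
  exact this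

/-- The loss from rate `2` to rate `3 r / 2` pays for the factor `2` of the two-sided Hoeffding
bound: with `s = 1 - r` the claim reads `2 * √s ≤ exp (t * (1 + 3 * s) / 2)`, and
`2 * √s ≤ 1 + s`. -/
theorem two_mul_exp_le {r t : ℝ} (hr : r ∈ Set.Ioo (0 : ℝ) 1) (ht : 1 ≤ t) :
    2 * Real.exp (-(2 * t)) ≤ 1 / √(1 - r) * Real.exp (-(3 * r / 2) * t) := by
  have hs : 0 < 1 - r := by linarith [hr.2]
  have hs' : 0 < √(1 - r) := Real.sqrt_pos.mpr hs
  have h1 : 2 * √(1 - r) ≤ Real.exp (2 * t - 3 * r / 2 * t) := by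
    have := Real.add_one_le_exp (2 * t - 3 * r / 2 * t)
    have hsq := Real.sq_sqrt hs.le
    nlinarith [sq_nonneg (√(1 - r) - 1), mul_nonneg hs.le (sub_nonneg.mpr ht)]
  have h2 : Real.exp (-(3 * r / 2) * t) =
      Real.exp (2 * t - 3 * r / 2 * t) * Real.exp (-(2 * t)) := by
    rw [← Real.exp_add]
    ring_nf
  rw [h2, one_div, inv_mul_eq_div, le_div_iff₀ hs']
  nlinarith [Real.exp_pos (-(2 * t))]

/-- The range in which the probability bound is trivial. -/
theorem one_le_bound {r t : ℝ} (hr : r ∈ Set.Ioo (0 : ℝ) 1) (ht : t < 3 / 2) {n : ℕ}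
    (hn : 2 ≤ n) : 1 ≤ ((n : ℝ) + 1) / √(1 - r) * Real.exp (-(3 * r / 2) * t) := by
  have hn' : (2 : ℝ) ≤ n := by exact_mod_cast hn
  have hs : 0 < 1 - r := by linarith [hr.2]
  have hs' : 0 < √(1 - r) := Real.sqrt_pos.mpr hs
  have hE : 0 < Real.exp (-(3 * r / 2) * t) := Real.exp_pos _
  have h7 : Real.exp (7 / 2) ≤ 39 := by
    have h1 : Real.exp (7 / 2) ^ 2 ≤ 39 ^ 2 := by
      rw [← Real.exp_nat_mul]
      calc Real.exp ((2 : ℕ) * (7 / 2)) ≤ Real.exp 7 := by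
            apply Real.exp_le_exp.mpr
            norm_num
        _ = Real.exp 1 ^ 7 := by rw [← Real.exp_nat_mul]; norm_num
        _ ≤ 2.7182818286 ^ 7 := by gcongr; exact Real.exp_one_lt_d9.le
        _ ≤ 39 ^ 2 := by norm_num
    exact le_of_sq_le_sq h1 (by norm_num)
  -- After squaring, `t ≤ 3 / 2` reduces the claim to `s ≤ 9 * exp (9 / 2 * (s - 1))` for
  -- `s = 1 - r`, which follows from `9 / 2 * s ≤ exp (9 / 2 * s - 1)` and `exp (7 / 2) ≤ 81 / 2`.
  have hsq : √(1 - r) ≤ 3 * Real.exp (-(3 * r / 2) * t) := by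
    apply Real.sqrt_le_iff.mpr
    refine ⟨by positivity, ?_⟩
    have h2 : Real.exp (-(9 / 2 * r)) ≤ Real.exp (-(3 * r / 2) * t) ^ 2 := by
      rw [← Real.exp_nat_mul]
      apply Real.exp_le_exp.mpr
      push_cast
      nlinarith [hr.1]
    have h3 : 9 / 2 * (1 - r) ≤ Real.exp (7 / 2) * Real.exp (-(9 / 2 * r)) := by
      rw [← Real.exp_add]
      have := Real.add_one_le_exp (7 / 2 + -(9 / 2 * r))
      linarith
    have h4 : 0 < Real.exp (-(9 / 2 * r)) := Real.exp_pos _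
    nlinarith
  rw [div_mul_eq_mul_div, le_div_iff₀ hs', one_mul]
  nlinarith

end RandomBernstein

theorem theorem5p2 {Ω : Type*} [MeasurableSpace Ω]
    (P : MeasureTheory.Measure Ω) [MeasureTheory.IsProbabilityMeasure P]
    (u : ℝ → ℝ) (hu_mono : StrictMonoOn u (Set.Icc 0 1))
    (hu_conc : ConcaveOn ℝ (Set.Icc 0 1) u) (hu0 : u 0 = 0) (hu1 : u 1 = 1)
    (u'0 : ℝ) (hu' : HasDerivWithinAt u u'0 (Set.Icc 0 1) 0) (hu'_pos : 0 < u'0)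
    (V : (n : ℕ) → Fin (n + 1) → Ω → unitInterval)
    (hV_meas : ∀ n j, Measurable (V n j))
    (hV_indep : ∀ n, ProbabilityTheory.iIndepFun (V n) P)
    (hV_unif : ∀ n j, P.map (V n j) = MeasureTheory.volume)
    (τ : ℕ → ℝ) (hτ : Filter.Tendsto τ Filter.atTop Filter.atTop)
    (hτ_div : Filter.Tendsto (fun n : ℕ => τ n / (n : ℝ)) Filter.atTop (nhds 0))
    (hτ_one : ∀ n : ℕ, 1 ≤ n → 1 ≤ τ n)
    (f : unitInterval → Ω → ℝ) (hf_meas : ∀ x, Measurable (f x))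
    (hf_cont : Equicontinuous (fun (ω : Ω) (x : unitInterval) => f x ω))
    (r : ℝ) (hr : r ∈ Set.Ioo (0 : ℝ) 1) (n : ℕ) (hn : 1 ≤ n) :
    MeasurableSet {ω : Ω |
        (1 + RandomBernstein.sikkemaConstant) *
            RandomBernstein.uniformModulus f (Real.sqrt (τ n / (n : ℝ))) <
          ⨆ x : unitInterval,
            |RandomBernstein.stochasticBernstein f (RandomBernstein.nodes V) n x ω - f x ω|} ∧
      RandomBernstein.distortedProbability u P {ω : Ω |
        (1 + RandomBernstein.sikkemaConstant) *
            RandomBernstein.uniformModulus f (Real.sqrt (τ n / (n : ℝ))) <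
          ⨆ x : unitInterval,
            |RandomBernstein.stochasticBernstein f (RandomBernstein.nodes V) n x ω - f x ω|} ≤
        u'0 * (((n : ℝ) + 1) / Real.sqrt (1 - r)) * Real.exp (-(3 * r / 2) * τ n) := by
  have hτn : 1 ≤ τ n := hτ_one n hn
  have hn' : (0 : ℝ) < n := by exact_mod_cast hn
  have hf_sec : ∀ ω, Continuous fun x ↦ f x ω := fun ω ↦ hf_cont.continuous ω
  refine ⟨RandomBernstein.measurableSet_lt_iSup (fun ω ↦
    ((RandomBernstein.continuous_stochasticBernstein f _ n ω).sub (hf_sec ω)).abs) (fun x ↦ ?_) _,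
    ?_⟩
  · exact ((RandomBernstein.measurable_stochasticBernstein hf_meas hf_sec
      (RandomBernstein.measurable_nodes hV_meas n) x).sub (hf_meas x)).abs
  set E : Set Ω := {ω : Ω |
        (1 + RandomBernstein.sikkemaConstant) *
            RandomBernstein.uniformModulus f (Real.sqrt (τ n / (n : ℝ))) <
          ⨆ x : unitInterval,
            |RandomBernstein.stochasticBernstein f (RandomBernstein.nodes V) n x ω - f x ω|}
  have hu_le : u (P.real E) ≤ u'0 * P.real E :=
    RandomBernstein.distortion_le hu_conc hu0 hu'
      ⟨MeasureTheory.measureReal_nonneg, MeasureTheory.measureReal_le_one⟩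
  refine hu_le.trans ?_
  rw [mul_assoc]
  refine mul_le_mul_of_nonneg_left ?_ hu'_pos.le
  by_cases hnt : n = 1 ∨ 3 / 2 ≤ τ n
  · have hsub : E ⊆ {ω | ∃ k : Fin (n + 1),
        √(τ n / n) < |(RandomBernstein.nodes V n k ω : ℝ) - (k : ℕ) / n|} := by
      intro ω hω
      by_contra hY
      simp only [Set.mem_ofPred_eq, not_exists, not_lt] at hY
      rw [Set.mem_ofPred_eq] at hω
      refine hω.not_ge (ciSup_le fun x ↦ ?_)
      exact RandomBernstein.abs_stochasticBernstein_sub_le hn hτn hnt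
        (fun x y hxy ↦ RandomBernstein.abs_sub_le_uniformModulus hf_cont ω hxy) hY x
    calc P.real E ≤ _ := MeasureTheory.measureReal_mono hsub
      _ ≤ 2 * (n + 1) * Real.exp (-(2 * (n + 1) * √(τ n / n) ^ 2)) :=
          RandomBernstein.measureReal_exists_nodes_far_le hV_meas hV_indep hV_unif n
            (Real.sqrt_nonneg _)
      _ ≤ 2 * (n + 1) * Real.exp (-(2 * τ n)) := by
          refine mul_le_mul_of_nonneg_left (Real.exp_le_exp.mpr (neg_le_neg ?_)) (by positivity)
          rw [Real.sq_sqrt (by positivity), ← mul_div_assoc, le_div_iff₀ hn']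
          nlinarith
      _ = (n + 1) * (2 * Real.exp (-(2 * τ n))) := by ring
      _ ≤ (n + 1) * (1 / √(1 - r) * Real.exp (-(3 * r / 2) * τ n)) := by
          refine mul_le_mul_of_nonneg_left ?_ (by positivity)
          exact RandomBernstein.two_mul_exp_le hr hτn
      _ = (n + 1) / √(1 - r) * Real.exp (-(3 * r / 2) * τ n) := by ring
  · push Not at hnt
    exact MeasureTheory.measureReal_le_one.trans
      (RandomBernstein.one_le_bound hr hnt.2 (by omega))
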